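/- Consider the triangular lattice with edges of length $1$. A rhombus is the union of two unit triangles of this lattice that share an edge, and a rhombus tiling of a region made up of unit triangles is a set of rhombi with pairwise disjoint interiors whose union is the region. Let $a,b,c$ be positive integers, all of the same parity. Take the lattice hexagon with all angles equal to $120^\circ$ and with side lengths $a,b+1,c,a+1,b,c+1$ in cyclic order. It is cut by lattice lines into $b+c+1$ strips parallel to its sides of lengths $a$ and $a+1$, into $a+c+1$ strips parallel to its sides of lengths $b$ and $b+1$, and into $a+b+1$ strips parallel to its sides of lengths $c$ and $c+1$; its central triangle is the unit triangle that lies in the middle strip in each of the three directions. For a partition $\lambda$ let $\lambda'$ denote the conjugate partition, and let $s_\lambda(X_n)=s_\lambda(x_1,\dots,x_n)$ be the Schur function in $n$ variables (which is $0$ if $\lambda$ has more than $n$ parts). Then the number of all rhombus tilings of the hexagon from which the central triangle has been removed equals $$\sum_{(\lambda,\mu)} \Big(s_\lambda(X_{(b+c+2)/2})\cdot s_\mu(X_{(b+c)/2})\Big)\Big|_{x_1=x_2=\dots=x_{(b+c+2)/2}=1},$$ where $(\lambda,\mu)$ ranges over all pairs of partitions for which there are an integer $k$ with $0\le k\le a$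 and integers $i_1,\dots,i_{a+1}$ with $$-\frac{a+b}{2}\le i_1<\dots<i_k<i_{k+1}=0<i_{k+2}<\dots<i_{a+1}\le\frac{a+b}{2}$$ such that $\lambda'$ has at most $a$ nonzero parts, $\mu'$ has at most $a+1$ nonzero parts, and $$\lambda'_h=\frac{b-a}{2}+i_{a+1-h+\chi(a+1-h\ge k+1)}+h\quad(h=1,\dots,a),\qquad \mu'_h=\frac{b-a}{2}-i_h+h-1\quad(h=1,\dots,a+1).$$ Here $\chi(\mathcal A)=1$ if $\mathcal A$ is true and $\chi(\mathcal A)=0$ otherwise. -/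

import Mathlib

/-! ### Rhombus tilings in the triangular lattice

The pair `(x, y) : ℤ × ℤ` stands for the point `x • (1, 0) + y • (1/2, √3/2)` of the plane, so that
`ℤ × ℤ` is the triangular lattice with edges of length `1`. -/

/-- A unit triangle of the triangular lattice: `up x y` has the horizontal edge from `(x, y)` to
`(x + 1, y)` as its base and lies above it; `down x y` has the horizontal edge from `(x, y + 1)`
to `(x + 1, y + 1)` as its top and lies below it. -/
inductive UnitTriangle : Type
  | up (x y : ℤ) : UnitTriangle
  | down (x y : ℤ) : UnitTriangle

/-- The three vertices of a unit triangle. -/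
def UnitTriangle.vertices : UnitTriangle → Finset (ℤ × ℤ)
  | .up x y => {(x, y), (x + 1, y), (x, y + 1)}
  | .down x y => {(x + 1, y), (x, y + 1), (x + 1, y + 1)}

/-- A rhombus with side lengths `1` and angles of 60° and 120°, given by the two unit triangles that
it consists of: these have an edge, i.e. exactly two vertices, in common. -/
def IsRhombus (r : Set UnitTriangle) : Prop :=
  ∃ s t : UnitTriangle, (s.vertices ∩ t.vertices).card = 2 ∧ r = {s, t}

/-- The rhombus tilings of a region made up of unit triangles: the sets of non-overlapping
rhombi whose union is the region. -/
def rhombusTilings (R : Set UnitTriangle) : Set (Set (Set UnitTriangle)) :=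
  {T | (∀ r ∈ T, IsRhombus r) ∧ T.PairwiseDisjoint id ∧ ⋃₀ T = R}

/-- The lattice points of the hexagon, all of whose angles are 120°, with vertices
`(0, a + c + 1)`, `(b, a + c + 1)`, `(b + c + 1, a)`, `(b + c + 1, 0)`, `(c, 0)`, `(0, c)`.
Starting from the side between the vertices `(b + c + 1, a)` and `(b + c + 1, 0)`, its sides have
the lengths `a, b + 1, c, a + 1, b, c + 1`. -/
def hexagonPoints (a b c : ℕ) : Set (ℤ × ℤ) :=
  {p | 0 ≤ p.1 ∧ p.1 ≤ b + c + 1 ∧ 0 ≤ p.2 ∧ p.2 ≤ a + c + 1 ∧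
    c ≤ p.1 + p.2 ∧ p.1 + p.2 ≤ a + b + c + 1}

/-- The unit triangles of the hexagon with sides `a, b + 1, c, a + 1, b, c + 1`. -/
def hexagon (a b c : ℕ) : Set UnitTriangle :=
  {t | ∀ p ∈ t.vertices, p ∈ hexagonPoints a b c}

/-- The central triangle of the hexagon, for `a, b, c` of the same parity. The hexagon is cut
into `b + c + 1` strips of unit width parallel to its sides of lengths `a` and `a + 1`, into
`a + c + 1` strips parallel to its sides of lengths `b` and `b + 1`, and into `a + b + 1` strips
parallel to its sides of lengths `c` and `c + 1`. The central triangle is the only unit triangle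
that lies in the middle strip in all three directions. -/
def centralTriangle (a b c : ℕ) : UnitTriangle :=
  .up ((b + c) / 2) ((a + c) / 2)

/-- The punctured hexagon. -/
def puncturedHexagon (a b c : ℕ) : Set UnitTriangle :=
  hexagon a b c \ {centralTriangle a b c}

/-! ### Schur functions -/

/-- The semistandard tableaux of shape `lam` with entries among `0, 1, …, n - 1`. -/
def BoundedTableau (n : ℕ) (lam : YoungDiagram) : Type :=
  {T : SemistandardYoungTableau lam // ∀ i j, (i, j) ∈ lam → T i j < n}

instance BoundedTableau.instFinite (n : ℕ) (lam : YoungDiagram) :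
    Finite (BoundedTableau n lam) := by
  refine Finite.of_injective
    (β := {x // x ∈ lam.cells} → Fin n)
    (fun T x => ⟨T.1 x.1.1 x.1.2, T.2 _ _ ((YoungDiagram.mem_cells _).1 x.2)⟩) ?_
  intro S T h
  apply Subtype.ext
  apply SemistandardYoungTableau.ext
  intro i j
  by_cases hij : (i, j) ∈ lam
  · have := congrFun h ⟨(i, j), (YoungDiagram.mem_cells _).2 hij⟩
    simpa using this
  · rw [S.1.zeros hij, T.1.zeros hij]

noncomputable instance BoundedTableau.instFintype (n : ℕ) (lam : YoungDiagram) :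
    Fintype (BoundedTableau n lam) :=
  Fintype.ofFinite _

/-- The Schur function `s_lam(x₁, …, xₙ)`: the sum, over all semistandard tableaux of shape `lam` with
`n` possible entries, of the product of the variables indexed by the entries. The variable
`MvPolynomial.X m` stands for `x_{m + 1}`. -/
noncomputable def schurFunction (n : ℕ) (lam : YoungDiagram) : MvPolynomial ℕ ℤ :=
  ∑ T : BoundedTableau n lam, ∏ x ∈ lam.cells, MvPolynomial.X (T.1 x.1 x.2)

/-! ### The pairs of partitions -/

/-- The `h`-th part, `h ≥ 1`, of the partition conjugate to `lam`. -/
def conjugatePart (lam : YoungDiagram) (h : ℕ) : ℕ := lam.transpose.rowLen (h - 1)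

/-- The pairs `(lam, mu)` of partitions whose conjugates have, for some `0 ≤ k ≤ a` and some integers
`-(a + b) / 2 ≤ i₁ < ⋯ < i_k < i_{k + 1} = 0 < i_{k + 2} < ⋯ < i_{a + 1} ≤ (a + b) / 2`, the parts
`(b - a) / 2 + i_{a + 1 - h + χ(a + 1 - h ≥ k + 1)} + h`, `1 ≤ h ≤ a`, respectively
`(b - a) / 2 - i_h + h - 1`, `1 ≤ h ≤ a + 1`. (It is understood that `a` and `b` have the same
parity.) -/
def partitionPairs (a b : ℕ) : Set (YoungDiagram × YoungDiagram) :=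
  {p | ∃ k : ℕ, k ≤ a ∧ ∃ i : ℕ → ℤ,
    -(((a : ℤ) + b) / 2) ≤ i 1 ∧ StrictMonoOn i (Set.Icc 1 (a + 1)) ∧ i (k + 1) = 0 ∧
    i (a + 1) ≤ ((a : ℤ) + b) / 2 ∧
    (∀ h, 1 ≤ h → h ≤ a → (conjugatePart p.1 h : ℤ) =
      ((b : ℤ) - a) / 2 + i (a + 1 - h + if k + 1 ≤ a + 1 - h then 1 else 0) + h) ∧
    (∀ h, a < h → conjugatePart p.1 h = 0) ∧
    (∀ h, 1 ≤ h → h ≤ a + 1 → (conjugatePart p.2 h : ℤ) =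
      ((b : ℤ) - a) / 2 - i h + h - 1) ∧
    (∀ h, a + 1 < h → conjugatePart p.2 h = 0)}

/-! A tiling is a perfect matching of upward with downward triangles, and hence a family of
non-intersecting paths crossing the edges parallel to the sides `a` and `a + 1`. With `m = (b + c) /
2` and `y₀ = (a + c) / 2`, there are `a + 1` paths starting on the left side; `a` of them reach the
right side and one ends at the left edge `(m, y₀)` of the removed triangle (`IsPathSystem`).

Cut the paths at abscissa `m`. The left half has `a + 1` paths of `m` steps, the right half, read
from right to left, has `a` paths of `m + 1` steps. After a shear (and, on the right, a reflection)
each step is `0` or `1` and the starting points are consecutive. Such a family is a semistandard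
tableau: column `h` lists the times at which the `h`-th path rises. Column strictness says that a
step rises at most once, and weak increase along rows is disjointness. The column lengths, the parts
of the conjugate partition, give the endpoints on the line of abscissa `m`. Here `i_h` is the depth
of the `h`-th left endpoint below `y₀`, so `i_{k+1} = 0` marks the path that stops, and the right
paths must meet the others.

For fixed endpoints the halves are independent, and a Schur function at `1, …, 1` counts tableaux,
whence the sum of products. The main steps are `exists_isColumnArray` (paths to arrays),
`IsPathData.isPathSystem` and `IsPathSystem.exists_isPathData` (gluing and cutting),
`mem_partitionPairs_iff` (endpoints as partitions) and `exists_bijective_rhombusTilings`. -/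

/-! ### Tableaux as column arrays -/

/-- Arrays recording, for every column `h` of a semistandard tableau with entries among
`0, …, n - 1`, the number `g h x` of entries smaller than `x`. -/
structure IsColumnArray (n : ℕ) (g : ℕ → ℕ → ℕ) : Prop where
  zero : ∀ h, g h 0 = 0
  le_succ : ∀ h x, g h x ≤ g h (x + 1)
  succ_le : ∀ h x, g h (x + 1) ≤ g h x + 1
  succ_left_le : ∀ h x, g (h + 1) x ≤ g h x
  eq_of_le : ∀ h x, n ≤ x → g h x = g h n

namespace IsColumnArray

variable {n : ℕ} {g : ℕ → ℕ → ℕ}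

theorem monotone (hg : IsColumnArray n g) (h : ℕ) : Monotone (g h) :=
  monotone_nat_of_le_succ (hg.le_succ h)

theorem antitone (hg : IsColumnArray n g) (x : ℕ) : Antitone fun h => g h x :=
  antitone_nat_of_succ_le fun h => hg.succ_left_le h x

theorem le_add (hg : IsColumnArray n g) (h x d : ℕ) : g h (x + d) ≤ g h x + d := by
  induction d with
  | zero => simp
  | succ d ih => have := hg.succ_le h (x + d); grind

theorem le_self (hg : IsColumnArray n g) (h x : ℕ) : g h x ≤ x := by
  have := hg.le_add h 0 x
  rw [hg.zero] at this
  simpa using this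

end IsColumnArray

/-- The tableau `T` and the array `g` describe each other. -/
def Describes {lam : YoungDiagram} (T : SemistandardYoungTableau lam) (g : ℕ → ℕ → ℕ) : Prop :=
  ∀ i h x, i < g h x ↔ (i, h) ∈ lam ∧ T i h < x

namespace Describes

variable {lam : YoungDiagram}

theorem tableau_ext {S T : SemistandardYoungTableau lam} {g : ℕ → ℕ → ℕ} (hS : Describes S g)
    (hT : Describes T g) : S = T := by
  apply SemistandardYoungTableau.ext
  intro i h
  by_cases hi : (i, h) ∈ lam
  · have h1 := (hS i h (T i h + 1)).1 ((hT i h (T i h + 1)).2 ⟨hi, Nat.lt_succ_self _⟩)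
    have h2 := (hT i h (S i h + 1)).1 ((hS i h (S i h + 1)).2 ⟨hi, Nat.lt_succ_self _⟩)
    omega
  · rw [S.zeros hi, T.zeros hi]

theorem array_ext {T : SemistandardYoungTableau lam} {g g' : ℕ → ℕ → ℕ} (hg : Describes T g)
    (hg' : Describes T g') : g = g' := by
  funext h x
  have h1 := hg (g h x) h x
  have h2 := hg' (g h x) h x
  have h3 := hg (g' h x) h x
  have h4 := hg' (g' h x) h x
  have h5 := h1.trans h2.symm
  have h6 := h3.trans h4.symm
  omega

end Describes

/-- The number of entries smaller than `x` in column `h` of a tableau. -/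
def SemistandardYoungTableau.columnArray {lam : YoungDiagram} (T : SemistandardYoungTableau lam)
    (h x : ℕ) : ℕ :=
  ((Finset.range (lam.colLen h)).filter fun i => T i h < x).card

theorem SemistandardYoungTableau.describes_columnArray {lam : YoungDiagram}
    (T : SemistandardYoungTableau lam) : Describes T T.columnArray := by
  intro i h x
  unfold SemistandardYoungTableau.columnArray
  set s := (Finset.range (lam.colLen h)).filter fun i => T i h < x with hs
  -- Columns increase strictly, so the entries below `x` occupy an initial segment of rows.
  have hlow : ∀ j ∈ s, ∀ i ≤ j, i ∈ s := by
    intro j hj i hij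
    simp only [hs, Finset.mem_filter, Finset.mem_range] at hj ⊢
    rcases hij.eq_or_lt with rfl | hij
    · exact hj
    · have := T.col_strict hij (YoungDiagram.mem_iff_lt_colLen.2 hj.1)
      exact ⟨hij.trans hj.1, this.trans hj.2⟩
  have key : i < s.card ↔ i ∈ s := by
    constructor
    · intro hi
      by_contra hc
      have : s ⊆ Finset.range i := by
        intro j hj
        rw [Finset.mem_range]
        by_contra hji
        exact hc (hlow j hj i (not_lt.1 hji))
      have := Finset.card_le_card this
      rw [Finset.card_range] at this
      omega
    · intro hi
      have : Finset.range (i + 1) ⊆ s := by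
        intro j hj
        rw [Finset.mem_range] at hj
        exact hlow i hi j (by omega)
      have := Finset.card_le_card this
      rw [Finset.card_range] at this
      omega
  rw [key, hs, Finset.mem_filter, Finset.mem_range, YoungDiagram.mem_iff_lt_colLen]

/-- `succ_le` reflects column strictness, `succ_left_le` weak increase along rows, and `eq_of_le`
the bound on the entries. -/
theorem BoundedTableau.isColumnArray {n : ℕ} {lam : YoungDiagram} (T : BoundedTableau n lam) :
    IsColumnArray n T.1.columnArray := by
  have hd := T.1.describes_columnArray
  refine ⟨fun h => ?_, fun h x => ?_, fun h x => ?_, fun h x => ?_, fun h x hx => ?_⟩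
  · by_contra hne
    have := (hd 0 h 0).1 (Nat.pos_of_ne_zero hne)
    omega
  · by_contra! hlt
    have h1 := (hd _ h _).1 hlt
    have h2 := (hd (T.1.columnArray h (x + 1)) h (x + 1)).2 ⟨h1.1, by omega⟩
    omega
  · by_contra! hlt
    obtain ⟨h1, h2⟩ := (hd _ h _).1 hlt
    have h3 := T.1.col_strict (Nat.lt_succ_self (T.1.columnArray h x)) h1
    have h4 := (hd (T.1.columnArray h x) h x).2
      ⟨lam.up_left_mem (Nat.le_succ _) le_rfl h1, by simp only [Nat.succ_eq_add_one] at *; omega⟩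
    omega
  · by_contra! hlt
    obtain ⟨h1, h2⟩ := (hd _ (h + 1) _).1 hlt
    have h3 := T.1.row_weak (Nat.lt_succ_self h) h1
    have h4 := (hd (T.1.columnArray h x) h x).2
      ⟨lam.up_left_mem le_rfl (Nat.le_succ _) h1, by simp only [Nat.succ_eq_add_one] at *; omega⟩
    omega
  · refine le_antisymm ?_ ?_
    · by_contra! hlt
      obtain ⟨h1, h2⟩ := (hd _ h _).1 hlt
      have := (hd _ h n).2 ⟨h1, T.2 _ _ h1⟩
      omega
    · by_contra! hlt
      obtain ⟨h1, h2⟩ := (hd _ h _).1 hlt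
      have := (hd _ h x).2 ⟨h1, by omega⟩
      omega

theorem BoundedTableau.columnArray_eq_colLen {n : ℕ} {lam : YoungDiagram}
    (T : BoundedTableau n lam) (h : ℕ) : T.1.columnArray h n = lam.colLen h := by
  unfold SemistandardYoungTableau.columnArray
  rw [Finset.filter_true_of_mem, Finset.card_range]
  intro i hi
  exact T.2 _ _ (YoungDiagram.mem_iff_lt_colLen.2 (Finset.mem_range.1 hi))

theorem BoundedTableau.columnArray_injective (n : ℕ) (lam : YoungDiagram) :
    Function.Injective fun T : BoundedTableau n lam => T.1.columnArray := by
  intro S T hST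
  have hS := S.1.describes_columnArray
  simp only at hST
  rw [hST] at hS
  exact Subtype.ext (hS.tableau_ext T.1.describes_columnArray)

/-- The entry in row `i` of column `h` is the value at which `g h` first exceeds `i`. -/
theorem IsColumnArray.exists_tableau {n : ℕ} {lam : YoungDiagram} {g : ℕ → ℕ → ℕ}
    (hg : IsColumnArray n g) (hlam : ∀ h, g h n = lam.colLen h) :
    ∃ T : BoundedTableau n lam, T.1.columnArray = g := by
  classical
  have hex : ∀ i h, (i, h) ∈ lam → ∃ v, v < n ∧ i < g h (v + 1) := by
    intro i h hi
    rw [YoungDiagram.mem_iff_lt_colLen, ← hlam] at hi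
    rcases n with - | n
    · rw [hg.zero] at hi; omega
    · exact ⟨n, Nat.lt_succ_self n, hi⟩
  have hle : ∀ h x, g h x ≤ lam.colLen h := by
    intro h x
    rw [← hlam]
    rcases le_total x n with hx | hx
    · exact hg.monotone h hx
    · exact (hg.eq_of_le h x hx).le
  let t : ℕ → ℕ → ℕ := fun i h =>
    if hi : (i, h) ∈ lam then Nat.find (hex i h hi) else 0
  have ht : ∀ i h, (i, h) ∈ lam → ∀ x, t i h < x ↔ i < g h x := by
    intro i h hi x
    simp only [t, dif_pos hi]
    obtain ⟨h1, h2⟩ := Nat.find_spec (hex i h hi)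
    constructor
    · intro hx
      exact h2.trans_le (hg.monotone h hx)
    · intro hx
      by_contra! hc
      rcases x with - | x
      · rw [hg.zero] at hx; omega
      · exact Nat.find_min (hex i h hi) (m := x) (by omega) ⟨by omega, hx⟩
  let T : SemistandardYoungTableau lam :=
    { entry := t
      row_weak' := by
        intro i h1 h2 hh hi
        have hi1 : (i, h1) ∈ lam := lam.up_left_mem le_rfl hh.le hi
        have := (ht i h2 hi (t i h2 + 1)).1 (Nat.lt_succ_self _)
        have := (ht i h1 hi1 (t i h2 + 1)).2 (this.trans_le (hg.antitone _ hh.le))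
        omega
      col_strict' := by
        intro i1 i2 h hh hi
        have hi1 : (i1, h) ∈ lam := lam.up_left_mem hh.le le_rfl hi
        have := (ht i2 h hi (t i2 h + 1)).1 (Nat.lt_succ_self _)
        have h3 := hg.succ_le h (t i2 h)
        exact (ht i1 h hi1 (t i2 h)).2 (by omega)
      zeros' := by
        intro i h hi
        simp only [t, dif_neg hi] }
  have hT : Describes T g := by
    intro i h x
    constructor
    · intro hi
      have hm : (i, h) ∈ lam := YoungDiagram.mem_iff_lt_colLen.2 (hi.trans_le (hle h x))
      exact ⟨hm, (ht i h hm x).2 hi⟩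
    · rintro ⟨hm, hi⟩
      exact (ht i h hm x).1 hi
  refine ⟨⟨T, fun i h hi => ?_⟩, T.describes_columnArray.array_ext hT⟩
  have : i < g h n := by rwa [hlam, ← YoungDiagram.mem_iff_lt_colLen]
  exact ((hT i h n).1 this).2

theorem eval_one_schurFunction (n : ℕ) (lam : YoungDiagram) :
    MvPolynomial.eval (fun _ => (1 : ℤ)) (schurFunction n lam) =
      Nat.card (BoundedTableau n lam) := by
  simp [schurFunction]

/-! ### Rhombus tilings as perfect matchings -/

namespace UnitTriangle

/-- The second triangle of a rhombus with first triangle `up u.1 u.2` is `down d.1 d.2`. -/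
def Adjacent (u d : ℤ × ℤ) : Prop := d = u ∨ d = (u.1, u.2 - 1) ∨ d = (u.1 - 1, u.2)

theorem card_up_inter_down (u d : ℤ × ℤ) :
    ((up u.1 u.2).vertices ∩ (down d.1 d.2).vertices).card = 2 ↔ Adjacent u d := by
  obtain ⟨x, y⟩ := u
  obtain ⟨z, w⟩ := d
  simp only [vertices, Adjacent, Prod.mk.injEq]
  constructor
  · intro h
    by_contra hc
    have : (({(x, y), (x + 1, y), (x, y + 1)} : Finset (ℤ × ℤ)) ∩
        {(z + 1, w), (z, w + 1), (z + 1, w + 1)}).card ≤ 1 := by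
      rw [Finset.card_le_one]
      simp only [Finset.mem_inter, Finset.mem_insert, Finset.mem_singleton, Prod.forall,
        Prod.mk.injEq]
      intro p q hpq r s hrs
      omega
    omega
  · rintro (⟨rfl, rfl⟩ | ⟨rfl, rfl⟩ | ⟨rfl, rfl⟩)
    · rw [Finset.card_eq_two]
      refine ⟨(z + 1, w), (z, w + 1), by simp, ?_⟩
      ext ⟨p, q⟩
      simp only [Finset.mem_inter, Finset.mem_insert, Finset.mem_singleton, Prod.mk.injEq]
      omega
    · rw [Finset.card_eq_two]
      refine ⟨(z, y), (z + 1, y), by simp, ?_⟩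
      ext ⟨p, q⟩
      simp only [Finset.mem_inter, Finset.mem_insert, Finset.mem_singleton, Prod.mk.injEq]
      omega
    · rw [Finset.card_eq_two]
      refine ⟨(x, w), (x, w + 1), by simp, ?_⟩
      ext ⟨p, q⟩
      simp only [Finset.mem_inter, Finset.mem_insert, Finset.mem_singleton, Prod.mk.injEq]
      omega

theorem card_up_inter_up (x y z w : ℤ) :
    ((up x y).vertices ∩ (up z w).vertices).card ≠ 2 := by
  intro h
  by_cases he : x = z ∧ y = w
  · obtain ⟨rfl, rfl⟩ := he
    simp [vertices] at h
  · have : ((up x y).vertices ∩ (up z w).vertices).card ≤ 1 := by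
      rw [Finset.card_le_one]
      simp only [vertices, Finset.mem_inter, Finset.mem_insert, Finset.mem_singleton, Prod.forall,
        Prod.mk.injEq]
      intro p q hpq r s hrs
      omega
    omega

theorem card_down_inter_down (x y z w : ℤ) :
    ((down x y).vertices ∩ (down z w).vertices).card ≠ 2 := by
  intro h
  by_cases he : x = z ∧ y = w
  · obtain ⟨rfl, rfl⟩ := he
    simp [vertices] at h
  · have : ((down x y).vertices ∩ (down z w).vertices).card ≤ 1 := by
      rw [Finset.card_le_one]
      simp only [vertices, Finset.mem_inter, Finset.mem_insert, Finset.mem_singleton, Prod.forall,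
        Prod.mk.injEq]
      intro p q hpq r s hrs
      omega
    omega

/-- The rhombus, or else the pair of disjoint triangles, with triangles `up` and `down`. -/
def pair (u d : ℤ × ℤ) : Set UnitTriangle := {up u.1 u.2, down d.1 d.2}

@[simp] theorem up_mem_pair {u d : ℤ × ℤ} {x y : ℤ} : up x y ∈ pair u d ↔ (x, y) = u := by
  simp [pair, Prod.ext_iff]

@[simp] theorem down_mem_pair {u d : ℤ × ℤ} {x y : ℤ} : down x y ∈ pair u d ↔ (x, y) = d := by
  simp [pair, Prod.ext_iff]

theorem pair_inj {u d u' d' : ℤ × ℤ} : pair u d = pair u' d' ↔ u = u' ∧ d = d' := by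
  constructor
  · intro h
    have h1 : up u.1 u.2 ∈ pair u' d' := h ▸ up_mem_pair.2 rfl
    have h2 : down d.1 d.2 ∈ pair u' d' := h ▸ down_mem_pair.2 rfl
    exact ⟨up_mem_pair.1 h1, down_mem_pair.1 h2⟩
  · rintro ⟨rfl, rfl⟩
    rfl

end UnitTriangle

open UnitTriangle in
-- Adjacency of unit triangles is bipartite: distinct triangles of the same orientation share at
-- most one vertex.
theorem isRhombus_iff (r : Set UnitTriangle) :
    IsRhombus r ↔ ∃ u d, Adjacent u d ∧ r = pair u d := by
  constructor
  · rintro ⟨s | s, t | t, hst, rfl⟩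
    · exact absurd hst (card_up_inter_up _ _ _ _)
    · exact ⟨(_, _), (_, _), (card_up_inter_down (_, _) (_, _)).1 hst, rfl⟩
    · rw [Finset.inter_comm] at hst
      exact ⟨(_, _), (_, _), (card_up_inter_down (_, _) (_, _)).1 hst, Set.pair_comm _ _⟩
    · exact absurd hst (card_down_inter_down _ _ _ _)
  · rintro ⟨u, d, h, rfl⟩
    exact ⟨_, _, (card_up_inter_down u d).2 h, rfl⟩

open UnitTriangle in
/-- The perfect matchings of the upward with the downward triangles of a region that pair
triangles having an edge in common. -/
structure IsMatching (R : Set UnitTriangle) (M : ℤ × ℤ → ℤ × ℤ → Prop) : Prop where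
  up_mem : ∀ {u d}, M u d → up u.1 u.2 ∈ R
  down_mem : ∀ {u d}, M u d → down d.1 d.2 ∈ R
  adj : ∀ {u d}, M u d → Adjacent u d
  exists_down : ∀ u : ℤ × ℤ, up u.1 u.2 ∈ R → ∃ d, M u d
  exists_up : ∀ d : ℤ × ℤ, down d.1 d.2 ∈ R → ∃ u, M u d
  down_unique : ∀ {u d d'}, M u d → M u d' → d = d'
  up_unique : ∀ {u u' d}, M u d → M u' d → u = u'

open UnitTriangle in
theorem IsMatching.mem_rhombusTilings {R : Set UnitTriangle} {M : ℤ × ℤ → ℤ × ℤ → Prop}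
    (hM : IsMatching R M) : {r | ∃ u d, M u d ∧ r = pair u d} ∈ rhombusTilings R := by
  refine ⟨?_, ?_, ?_⟩
  · rintro r ⟨u, d, hud, rfl⟩
    exact (isRhombus_iff _).2 ⟨u, d, hM.adj hud, rfl⟩
  · rintro r ⟨u, d, h, rfl⟩ r' ⟨u', d', h', rfl⟩ hne
    rw [Function.onFun, Set.disjoint_left]
    rintro (⟨x, y⟩ | ⟨x, y⟩) h1 h2
    · obtain rfl := up_mem_pair.1 h1
      obtain rfl := up_mem_pair.1 h2
      exact hne (by rw [hM.down_unique h h'])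
    · obtain rfl := down_mem_pair.1 h1
      obtain rfl := down_mem_pair.1 h2
      exact hne (by rw [hM.up_unique h h'])
  · ext t
    constructor
    · rintro ⟨r, ⟨u, d, h, rfl⟩, ht⟩
      rcases t with ⟨x, y⟩ | ⟨x, y⟩
      · obtain rfl := up_mem_pair.1 ht
        exact hM.up_mem h
      · obtain rfl := down_mem_pair.1 ht
        exact hM.down_mem h
    · intro ht
      rcases t with ⟨x, y⟩ | ⟨x, y⟩
      · obtain ⟨d, h⟩ := hM.exists_down (x, y) ht
        exact ⟨_, ⟨_, _, h, rfl⟩, up_mem_pair.2 rfl⟩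
      · obtain ⟨u, h⟩ := hM.exists_up (x, y) ht
        exact ⟨_, ⟨_, _, h, rfl⟩, down_mem_pair.2 rfl⟩

open UnitTriangle in
theorem isMatching_of_mem_rhombusTilings {R : Set UnitTriangle} {T : Set (Set UnitTriangle)}
    (hT : T ∈ rhombusTilings R) :
    IsMatching R (fun u d => pair u d ∈ T) := by
  obtain ⟨h1, h2, h3⟩ := hT
  have hsub : ∀ r ∈ T, ∀ t ∈ r, t ∈ R := fun r hr t ht => h3 ▸ ⟨r, hr, ht⟩
  have huniq : ∀ r ∈ T, ∀ r' ∈ T, ∀ t, t ∈ r → t ∈ r' → r = r' := fun r hr r' hr' t ht ht' =>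
    h2.elim_set hr hr' t ht ht'
  refine ⟨fun h => hsub _ h _ (by simp), fun h => hsub _ h _ (by simp), fun {u d} h => ?_,
    fun u hu => ?_, fun d hd => ?_, fun {u d d'} h h' => ?_, fun {u u' d} h h' => ?_⟩
  · obtain ⟨u', d', ha, he⟩ := (isRhombus_iff _).1 (h1 _ h)
    obtain ⟨rfl, rfl⟩ := pair_inj.1 he
    exact ha
  · rw [← h3] at hu
    obtain ⟨r, hr, hur⟩ := hu
    obtain ⟨u', d', ha, rfl⟩ := (isRhombus_iff _).1 (h1 _ hr)
    obtain rfl := up_mem_pair.1 hur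
    exact ⟨d', hr⟩
  · rw [← h3] at hd
    obtain ⟨r, hr, hur⟩ := hd
    obtain ⟨u', d', ha, rfl⟩ := (isRhombus_iff _).1 (h1 _ hr)
    obtain rfl := down_mem_pair.1 hur
    exact ⟨u', hr⟩
  · exact (pair_inj.1 (huniq _ h _ h' (up u.1 u.2) (by simp) (by simp))).2
  · exact (pair_inj.1 (huniq _ h _ h' (down d.1 d.2) (by simp) (by simp))).1

/-- Any further rhombus would overlap one of `T`, which already covers the region. Surjectivity thus
needs only one inclusion. -/
theorem eq_of_mem_rhombusTilings_of_subset {R : Set UnitTriangle} {T T' : Set (Set UnitTriangle)}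
    (hT : T ∈ rhombusTilings R) (hT' : T' ∈ rhombusTilings R) (h : T ⊆ T') : T = T' := by
  refine h.antisymm fun r hr => ?_
  obtain ⟨s, t, -, rfl⟩ := hT'.1 r hr
  have hs : s ∈ ⋃₀ T := by
    rw [hT.2.2, ← hT'.2.2]
    exact ⟨_, hr, by simp⟩
  obtain ⟨r, hrT, hsr⟩ := hs
  rwa [← hT'.2.1.elim_set (h hrT) hr s hsr (by simp)]

/-! ### Tilings as non-intersecting paths -/

/-- The edge between `(x, y)` and `(x, y + 1)` belongs to the hexagon. -/
def IsVerticalEdge (a b c : ℕ) (x y : ℤ) : Prop :=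
  (0 ≤ x ∧ x ≤ b + c + 1) ∧ (0 ≤ y ∧ y ≤ a + c) ∧ c ≤ x + y ∧ x + y ≤ a + b + c

theorem up_mem_hexagon {a b c : ℕ} {x y : ℤ} :
    UnitTriangle.up x y ∈ hexagon a b c ↔ IsVerticalEdge a b c x y ∧ x ≤ b + c := by
  simp only [hexagon, hexagonPoints, UnitTriangle.vertices, Set.mem_ofPred_eq, Finset.mem_insert,
    Finset.mem_singleton, forall_eq_or_imp, forall_eq, IsVerticalEdge]
  omega

theorem down_mem_hexagon {a b c : ℕ} {x y : ℤ} :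
    UnitTriangle.down x y ∈ hexagon a b c ↔ IsVerticalEdge a b c (x + 1) y ∧ 0 ≤ x := by
  simp only [hexagon, hexagonPoints, UnitTriangle.vertices, Set.mem_ofPred_eq, Finset.mem_insert,
    Finset.mem_singleton, forall_eq_or_imp, forall_eq, IsVerticalEdge]
  omega

theorem up_mem_puncturedHexagon {a b c m y₀ : ℕ} (hm : 2 * m = b + c) (hy : 2 * y₀ = a + c)
    {x y : ℤ} : UnitTriangle.up x y ∈ puncturedHexagon a b c ↔
      IsVerticalEdge a b c x y ∧ x ≤ b + c ∧ ¬ (x = m ∧ y = y₀) := by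
  have h1 : ((b : ℤ) + c) / 2 = m := by omega
  have h2 : ((a : ℤ) + c) / 2 = y₀ := by omega
  rw [puncturedHexagon, Set.mem_sdiff, up_mem_hexagon, centralTriangle, h1, h2,
    Set.mem_singleton_iff, UnitTriangle.up.injEq, and_assoc]

theorem down_mem_puncturedHexagon {a b c : ℕ} {x y : ℤ} :
    UnitTriangle.down x y ∈ puncturedHexagon a b c ↔
      IsVerticalEdge a b c (x + 1) y ∧ 0 ≤ x := by
  simp [puncturedHexagon, centralTriangle, down_mem_hexagon]

/-- Systems of non-intersecting lattice paths in the hexagon: `P x` is the set of the vertical edges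
with abscissa `x` on the paths, and `S x y y'` says that a path goes from the edge at `(x, y)` to
the edge at `(x + 1, y')`. One of the paths ends at the edge at `(m, y₀)`. -/
structure IsPathSystem (a b c m y₀ : ℕ) (P : ℤ → ℤ → Prop) (S : ℤ → ℤ → ℤ → Prop) : Prop where
  isVerticalEdge : ∀ {x y}, P x y → IsVerticalEdge a b c x y
  first : ∀ {y}, IsVerticalEdge a b c 0 y → P 0 y
  last : ∀ {y}, IsVerticalEdge a b c (b + c + 1) y → P (b + c + 1) y
  center : P m y₀
  left_mem : ∀ {x y y'}, S x y y' → P x y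
  right_mem : ∀ {x y y'}, S x y y' → P (x + 1) y'
  ne_center : ∀ {x y y'}, S x y y' → ¬ (x = m ∧ y = y₀)
  step : ∀ {x y y'}, S x y y' → y' = y ∨ y' = y - 1
  exists_next : ∀ {x y}, P x y → x ≤ b + c → ¬ (x = m ∧ y = y₀) → ∃ y', S x y y'
  exists_prev : ∀ {x y'}, P (x + 1) y' → 0 ≤ x → ∃ y, S x y y'
  next_unique : ∀ {x y y₁ y₂}, S x y y₁ → S x y y₂ → y₁ = y₂
  prev_unique : ∀ {x y₁ y₂ y'}, S x y₁ y' → S x y₂ y' → y₁ = y₂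

/-- The matching that belongs to a system of non-intersecting paths. -/
def pathMatching (a b c : ℕ) (P : ℤ → ℤ → Prop) (S : ℤ → ℤ → ℤ → Prop) (u d : ℤ × ℤ) : Prop :=
  (u.1 = d.1 ∧ S u.1 u.2 d.2) ∨
    (d.1 + 1 = u.1 ∧ d.2 = u.2 ∧ IsVerticalEdge a b c u.1 u.2 ∧ ¬ P u.1 u.2)

section

variable {a b c m y₀ : ℕ}

/-- An upward triangle whose left edge is on a path is matched along the step leaving that edge;
otherwise the edge becomes the short diagonal of a rhombus. -/
theorem IsPathSystem.isMatching {P : ℤ → ℤ → Prop} {S : ℤ → ℤ → ℤ → Prop}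
    (hm : 2 * m = b + c) (hy : 2 * y₀ = a + c)
    (hS : IsPathSystem a b c m y₀ P S) :
    IsMatching (puncturedHexagon a b c) (pathMatching a b c P S) := by
  -- All edges on the left and right sides are on paths, so both triangles at an edge off the paths
  -- lie in the hexagon.
  have hN : ∀ {x y : ℤ}, IsVerticalEdge a b c x y → ¬ P x y → 0 < x ∧ x ≤ b + c := by
    intro x y he hP
    obtain ⟨⟨h1, h2⟩, -⟩ := id he
    constructor
    · by_contra hx
      obtain rfl : x = 0 := by omega
      exact hP (hS.first he)
    · by_contra hx
      obtain rfl : x = b + c + 1 := by omega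
      exact hP (hS.last he)
  constructor
  · rintro ⟨x, y⟩ ⟨z, w⟩ (⟨h1, h2⟩ | ⟨h1, h2, h3, h4⟩)
    · refine (up_mem_puncturedHexagon hm hy).2
        ⟨hS.isVerticalEdge (hS.left_mem h2), ?_, hS.ne_center h2⟩
      have := (hS.isVerticalEdge (hS.right_mem h2)).1
      omega
    · refine (up_mem_puncturedHexagon hm hy).2 ⟨h3, (hN h3 h4).2, ?_⟩
      rintro ⟨h5, h6⟩
      simp only at h4 h5 h6
      exact h4 (h5 ▸ h6 ▸ hS.center)
  · rintro ⟨x, y⟩ ⟨z, w⟩ (⟨h1, h2⟩ | ⟨h1, h2, h3, h4⟩)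
    · simp only at h1 h2
      subst h1
      exact down_mem_puncturedHexagon.2 ⟨hS.isVerticalEdge (hS.right_mem h2),
        (hS.isVerticalEdge (hS.left_mem h2)).1.1⟩
    · simp only at h1 h2 h3 h4
      subst h1 h2
      have := hN h3 h4
      exact down_mem_puncturedHexagon.2 ⟨h3, by omega⟩
  · rintro ⟨x, y⟩ ⟨z, w⟩ (⟨h1, h2⟩ | ⟨h1, h2, h3, h4⟩)
    · have := hS.step h2
      simp only [UnitTriangle.Adjacent, Prod.mk.injEq] at *
      omega
    · simp only [UnitTriangle.Adjacent, Prod.mk.injEq] at *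
      omega
  · rintro ⟨x, y⟩ hu
    obtain ⟨h1, h2, h3⟩ := (up_mem_puncturedHexagon hm hy).1 hu
    by_cases hP : P x y
    · obtain ⟨y', h⟩ := hS.exists_next hP h2 h3
      exact ⟨(x, y'), Or.inl ⟨rfl, h⟩⟩
    · exact ⟨(x - 1, y), Or.inr ⟨sub_add_cancel _ _, rfl, h1, hP⟩⟩
  · rintro ⟨x, y⟩ hd
    obtain ⟨h1, h2⟩ := down_mem_puncturedHexagon.1 hd
    by_cases hP : P (x + 1) y
    · obtain ⟨y', h⟩ := hS.exists_prev hP h2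
      exact ⟨(x, y'), Or.inl ⟨rfl, h⟩⟩
    · exact ⟨(x + 1, y), Or.inr ⟨rfl, rfl, h1, hP⟩⟩
  · rintro ⟨x, y⟩ ⟨z, w⟩ ⟨z', w'⟩ (⟨h1, h2⟩ | ⟨h1, h2, h3, h4⟩) (⟨h1', h2'⟩ | ⟨h1', h2', h3', h4'⟩)
    · exact Prod.ext (h1.symm.trans h1') (hS.next_unique h2 h2')
    · exact absurd (hS.left_mem h2) h4'
    · exact absurd (hS.left_mem h2') h4
    · simp only [Prod.mk.injEq] at *
      omega
  · rintro ⟨x, y⟩ ⟨x', y'⟩ ⟨z, w⟩ (⟨h1, h2⟩ | ⟨h1, h2, h3, h4⟩) (⟨h1', h2'⟩ | ⟨h1', h2', h3', h4'⟩)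
    · simp only at h1 h1' h2 h2'
      subst h1 h1'
      exact Prod.ext rfl (hS.prev_unique h2 h2')
    · simp only at h1 h1' h2 h2' h4'
      subst h1 h1' h2'
      exact absurd (hS.right_mem h2) h4'
    · simp only at h1 h1' h2 h2' h4
      subst h1 h1' h2
      exact absurd (hS.right_mem h2') h4
    · simp only [Prod.mk.injEq] at *
      omega

/-- Conversely, an edge is on a path exactly when the triangles on its two sides are not matched
with each other. -/
theorem IsMatching.isPathSystem {M : ℤ × ℤ → ℤ × ℤ → Prop}
    (hm : 2 * m = b + c) (hy : 2 * y₀ = a + c)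
    (hM : IsMatching (puncturedHexagon a b c) M) :
    IsPathSystem a b c m y₀ (fun x y => IsVerticalEdge a b c x y ∧ ¬ M (x, y) (x - 1, y))
      (fun x y y' => M (x, y) (x, y')) := by
  have hup : ∀ {x y d}, M (x, y) d →
      IsVerticalEdge a b c x y ∧ x ≤ b + c ∧ ¬ (x = m ∧ y = y₀) := fun h =>
    (up_mem_puncturedHexagon hm hy).1 (hM.up_mem h)
  have hdown : ∀ {x y u}, M u (x, y) → IsVerticalEdge a b c (x + 1) y ∧ 0 ≤ x := fun h =>
    down_mem_puncturedHexagon.1 (hM.down_mem h)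
  constructor
  · exact fun h => h.1
  · refine fun h => ⟨h, fun h' => ?_⟩
    have := (hdown h').2
    omega
  · refine fun h => ⟨h, fun h' => ?_⟩
    have := (hup h').2.1
    omega
  -- The triangle to the right of this edge is the removed one, so it has no partner.
  · refine ⟨?_, fun h' => (hup h').2.2 ⟨rfl, rfl⟩⟩
    unfold IsVerticalEdge
    omega
  · refine fun {x y y'} h => ⟨(hup h).1, fun h' => ?_⟩
    have := hM.down_unique h h'
    simp only [Prod.mk.injEq] at this
    omega
  · refine fun {x y y'} h => ⟨(hdown h).1, fun h' => ?_⟩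
    rw [add_sub_cancel_right] at h'
    have := hM.up_unique h h'
    simp only [Prod.mk.injEq] at this
    omega
  · exact fun h => (hup h).2.2
  · intro x y y' h
    have := hM.adj h
    simp only [UnitTriangle.Adjacent, Prod.mk.injEq] at this
    omega
  · rintro x y ⟨h1, h2⟩ h3 h4
    obtain ⟨⟨z, w⟩, h⟩ := hM.exists_down (x, y) ((up_mem_puncturedHexagon hm hy).2 ⟨h1, h3, h4⟩)
    have := hM.adj h
    simp only [UnitTriangle.Adjacent, Prod.mk.injEq] at this
    rcases this with ⟨rfl, -⟩ | ⟨rfl, -⟩ | ⟨rfl, rfl⟩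
    · exact ⟨_, h⟩
    · exact ⟨_, h⟩
    · exact absurd h h2
  · rintro x y ⟨h1, h2⟩ h3
    obtain ⟨⟨z, w⟩, h⟩ := hM.exists_up (x, y) (down_mem_puncturedHexagon.2 ⟨h1, h3⟩)
    have := hM.adj h
    simp only [UnitTriangle.Adjacent, Prod.mk.injEq] at this
    rcases this with ⟨rfl, -⟩ | ⟨rfl, -⟩ | ⟨hz, rfl⟩
    · exact ⟨_, h⟩
    · exact ⟨_, h⟩
    · obtain rfl : z = x + 1 := by omega
      rw [add_sub_cancel_right] at h2
      exact absurd h h2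
  · exact fun h h' => (Prod.ext_iff.1 (hM.down_unique h h')).2
  · exact fun h h' => (Prod.ext_iff.1 (hM.up_unique h h')).2

end

/-! ### From path families to column arrays -/

/-- A family of disjoint lattice paths with steps `0` and `1`, the `h`-th of which starts
at `s - h`, is recorded by a column array. -/
theorem exists_isColumnArray {r L : ℕ} {s : ℤ} {Q : ℕ → ℤ → Prop} {B : ℕ → ℤ → ℤ → Prop}
    (h0 : ∀ z, Q 0 z ↔ ∃ h : ℕ, h < r ∧ z = s - h)
    (mem : ∀ {t z z'}, t < L → B t z z' → Q (t + 1) z')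
    (step : ∀ {t z z'}, B t z z' → z' = z ∨ z' = z + 1)
    (next : ∀ {t z}, t < L → Q t z → ∃ z', B t z z')
    (prev : ∀ {t z'}, t < L → Q (t + 1) z' → ∃ z, Q t z ∧ B t z z')
    (next_unique : ∀ {t z z₁ z₂}, B t z z₁ → B t z z₂ → z₁ = z₂)
    (prev_unique : ∀ {t z₁ z₂ z'}, B t z₁ z' → B t z₂ z' → z₁ = z₂) :
    ∃ g : ℕ → ℕ → ℕ, IsColumnArray L g ∧ (∀ h, r ≤ h → g h L = 0) ∧
      (∀ t, t ≤ L → ∀ z, Q t z ↔ ∃ h : ℕ, h < r ∧ z = s - h + g h t) ∧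
      ∀ t, t < L → ∀ h : ℕ, h < r → B t (s - h + g h t) (s - h + g h (t + 1)) := by
  classical
  -- The conditions `t < L` and `h < r` make `g` constant after time `L` and zero beyond the last
  -- path.
  let rise : ℕ → ℕ → ℕ → Prop := fun h t x =>
    t < L ∧ h < r ∧ B t (s - h + x) (s - h + x + 1)
  let g : ℕ → ℕ → ℕ := fun h t =>
    Nat.rec (motive := fun _ => ℕ) 0 (fun t x => x + if rise h t x then 1 else 0) t
  have g0 : ∀ h, g h 0 = 0 := fun h => rfl
  have gs : ∀ h t, g h (t + 1) = g h t + if rise h t (g h t) then 1 else 0 := fun _ _ => rfl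
  clear_value g
  have hB : ∀ t, t < L → (∀ h : ℕ, h < r → Q t (s - h + g h t)) → ∀ h : ℕ, h < r →
      B t (s - h + g h t) (s - h + g h (t + 1)) := by
    intro t ht hQ h hh
    obtain ⟨z', hz⟩ := next ht (hQ h hh)
    rw [gs]
    rcases step hz with rfl | rfl
    · rw [if_neg]
      · simpa using hz
      · rintro ⟨-, -, h'⟩
        have := next_unique hz h'
        omega
    · rw [if_pos ⟨ht, hh, hz⟩]
      push_cast
      rwa [← add_assoc]
  have hI : ∀ t, t ≤ L → (∀ h : ℕ, h < r → Q t (s - h + g h t)) ∧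
      (∀ z, Q t z → ∃ h : ℕ, h < r ∧ z = s - h + g h t) ∧
      (∀ h, h + 1 < r → g (h + 1) t ≤ g h t) := by
    intro t
    induction t with
    | zero =>
      intro _
      simp only [g0, h0, Nat.cast_zero, add_zero, le_refl, implies_true, and_true]
      exact ⟨fun h hh => ⟨h, hh, rfl⟩, fun z hz => hz⟩
    | succ t ih =>
      intro ht
      obtain ⟨ih1, ih2, ih3⟩ := ih (by omega)
      have hB' := hB t ht ih1
      refine ⟨fun h hh => mem ht (hB' h hh), fun z hz => ?_, fun h hh => ?_⟩
      · obtain ⟨w, hw, hwz⟩ := prev ht hz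
        obtain ⟨h, hh, rfl⟩ := ih2 w hw
        exact ⟨h, hh, next_unique hwz (hB' h hh)⟩
      -- Steps being `0` or `1`, path `h + 1` could only overtake in the count by landing on path
      -- `h`; uniqueness of predecessors excludes this.
      · by_contra! hlt
        have e1 := ih3 h hh
        have e2 := hB' h (by omega)
        have e3 := hB' (h + 1) hh
        have e4 := step e2
        have e5 := step e3
        have e6 : s - (h + 1 : ℕ) + g (h + 1) (t + 1) = s - h + g h (t + 1) := by
          push_cast at *
          omega
        rw [e6] at e3
        have := prev_unique e2 e3
        push_cast at *
        omega
  have hz : ∀ h, r ≤ h → ∀ t, g h t = 0 := by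
    intro h hh t
    induction t with
    | zero => exact g0 h
    | succ t ih => rw [gs, if_neg (by simp only [rise]; omega), ih]
  have hc : ∀ h t, L ≤ t → g h t = g h L := by
    intro h t ht
    induction t, ht using Nat.le_induction with
    | base => rfl
    | succ t ht ih => rw [gs, if_neg (by simp only [rise]; omega), ih, add_zero]
  refine ⟨g, ⟨g0, fun h t => by rw [gs]; omega, fun h t => by rw [gs]; split_ifs <;> omega,
    fun h t => ?_, hc⟩, fun h hh => hz h hh L, fun t ht z => ⟨(hI t ht).2.1 z, ?_⟩,
    fun t ht => hB t ht (hI t ht.le).1⟩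
  · by_cases hh : h + 1 < r
    · rcases le_total t L with ht | ht
      · exact (hI t ht).2.2 h hh
      · rw [hc _ _ ht, hc _ _ ht]
        exact (hI L le_rfl).2.2 h hh
    · rw [hz (h + 1) (by omega)]
      exact Nat.zero_le _
  · rintro ⟨h, hh, rfl⟩
    exact (hI t ht).1 h hh

/-! ### Gluing the left and right halves -/

/-- The `r`-th natural number different from `k`. -/
def skip (k r : ℕ) : ℕ := if r < k then r else r + 1

/-- The height of the `h`-th path, counted from above, at abscissa `x` in the left part of the
hexagon; `g h x` is the number of its rising steps up to there. -/
def leftPos (a c : ℕ) (g : ℕ → ℕ → ℕ) (h x : ℕ) : ℤ := c + a - h - x + g h x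

/-- The height of the `h`-th path, counted from below, at distance `t` from the right side of the
hexagon; `g h t` is the number of its rising steps from there. -/
def rightPos (g : ℕ → ℕ → ℕ) (h t : ℕ) : ℤ := h + t - g h t

/-- Paths in the left and in the right part of the hexagon which make `v h` and `u h` rising steps,
respectively, fit together if one of the left paths ends at height `y₀`. -/
def IsGluing (a c m y₀ : ℕ) (u v : ℕ → ℕ) : Prop :=
  ∃ k ≤ a, (c + a - k - m + v k : ℤ) = y₀ ∧ ∀ h < a,
    (h + (m + 1) - u h : ℤ) = c + a - skip k (a - 1 - h) - m + v (skip k (a - 1 - h))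

/-- The column arrays that describe a system of non-intersecting paths in the hexagon. -/
structure IsPathData (a c m y₀ : ℕ) (gL gR : ℕ → ℕ → ℕ) : Prop where
  left : IsColumnArray m gL
  right : IsColumnArray (m + 1) gR
  left_zero : ∀ h, a < h → gL h m = 0
  right_zero : ∀ h, a ≤ h → gR h (m + 1) = 0
  glue : IsGluing a c m y₀ (fun h => gR h (m + 1)) fun h => gL h m

/-- The vertical edges on the paths. -/
def pathEdges (a c m : ℕ) (gL gR : ℕ → ℕ → ℕ) (x y : ℤ) : Prop :=
  (∃ h i : ℕ, h ≤ a ∧ i ≤ m ∧ x = i ∧ y = leftPos a c gL h i) ∨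
    ∃ h t : ℕ, h < a ∧ t ≤ m ∧ x + t = 2 * m + 1 ∧ y = rightPos gR h t

/-- The steps of the paths. -/
def pathSteps (a c m : ℕ) (gL gR : ℕ → ℕ → ℕ) (x y y' : ℤ) : Prop :=
  (∃ h i : ℕ, h ≤ a ∧ i < m ∧ x = i ∧ y = leftPos a c gL h i ∧ y' = leftPos a c gL h (i + 1)) ∨
    ∃ h t : ℕ, h < a ∧ t ≤ m ∧ x + t = 2 * m ∧ y = rightPos gR h (t + 1) ∧ y' = rightPos gR h t

namespace IsColumnArray

variable {n : ℕ} {g : ℕ → ℕ → ℕ}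

theorem leftPos_lt (hg : IsColumnArray n g) (a c x : ℕ) {h h' : ℕ} (hh : h < h') :
    leftPos a c g h' x < leftPos a c g h x := by
  have := hg.antitone x hh.le
  simp only [leftPos] at *
  omega

theorem leftPos_inj (hg : IsColumnArray n g) {a c x h h' : ℕ} :
    leftPos a c g h x = leftPos a c g h' x ↔ h = h' := by
  refine ⟨fun he => ?_, fun he => he ▸ rfl⟩
  rcases lt_trichotomy h h' with hh | hh | hh
  · exact absurd he (hg.leftPos_lt a c x hh).ne'
  · exact hh
  · exact absurd he (hg.leftPos_lt a c x hh).ne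

theorem rightPos_lt (hg : IsColumnArray n g) (t : ℕ) {h h' : ℕ} (hh : h < h') :
    rightPos g h t < rightPos g h' t := by
  have := hg.antitone t hh.le
  simp only [rightPos] at *
  omega

theorem rightPos_inj (hg : IsColumnArray n g) {t h h' : ℕ} :
    rightPos g h t = rightPos g h' t ↔ h = h' := by
  refine ⟨fun he => ?_, fun he => he ▸ rfl⟩
  rcases lt_trichotomy h h' with hh | hh | hh
  · exact absurd he (hg.rightPos_lt t hh).ne
  · exact hh
  · exact absurd he (hg.rightPos_lt t hh).ne'

theorem leftPos_le (hg : IsColumnArray n g) (a c h : ℕ) {i j : ℕ} (hij : i ≤ j) :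
    leftPos a c g h j ≤ leftPos a c g h i ∧
      leftPos a c g h i + i ≤ leftPos a c g h j + j := by
  obtain ⟨d, rfl⟩ := Nat.exists_eq_add_of_le hij
  have h1 := hg.monotone h hij
  have h2 := hg.le_add h i d
  simp only [leftPos]
  push_cast
  omega

theorem rightPos_le (hg : IsColumnArray n g) (h : ℕ) {i j : ℕ} (hij : i ≤ j) :
    rightPos g h i ≤ rightPos g h j ∧ rightPos g h j - j ≤ rightPos g h i - i := by
  obtain ⟨d, rfl⟩ := Nat.exists_eq_add_of_le hij
  have h1 := hg.monotone h hij
  have h2 := hg.le_add h i d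
  simp only [rightPos]
  push_cast
  omega

theorem eq_zero (hg : IsColumnArray n g) {h : ℕ} (hh : g h n = 0) (x : ℕ) : g h x = 0 := by
  rcases le_total x n with hx | hx
  · have := hg.monotone h hx
    omega
  · rw [hg.eq_of_le h x hx, hh]

end IsColumnArray

namespace IsPathData

variable {a b c m y₀ : ℕ} {gL gR : ℕ → ℕ → ℕ}

/-- The right paths continue the left paths other than the `k`-th. -/
theorem exists_glue (hd : IsPathData a c m y₀ gL gR) :
    ∃ k ≤ a, leftPos a c gL k m = y₀ ∧
      (∀ h < a, ∃ h' ≤ a, h' ≠ k ∧ rightPos gR h (m + 1) = leftPos a c gL h' m) ∧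
      ∀ h' ≤ a, h' ≠ k → ∃ h < a, rightPos gR h (m + 1) = leftPos a c gL h' m := by
  obtain ⟨k, hk, h1, h2⟩ := hd.glue
  refine ⟨k, hk, h1, fun h hh => ⟨skip k (a - 1 - h), ?_, ?_, ?_⟩, fun h' hh' hne => ?_⟩
  · unfold skip
    split_ifs <;> omega
  · unfold skip
    split_ifs <;> omega
  · have := h2 h hh
    simp only [rightPos, leftPos]
    push_cast
    exact this
  · have key : ∃ h < a, skip k (a - 1 - h) = h' := by
      rcases lt_or_gt_of_ne hne with hlt | hlt
      · refine ⟨a - 1 - h', by omega, ?_⟩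
        unfold skip
        split_ifs <;> omega
      · refine ⟨a - h', by omega, ?_⟩
        unfold skip
        split_ifs <;> omega
    obtain ⟨h, hh, rfl⟩ := key
    have := h2 h hh
    refine ⟨h, hh, ?_⟩
    simp only [rightPos, leftPos]
    push_cast
    exact this

/-- Each half automatically respects the two slanted sides next to its starting side. The other two
bounds come from the opposite half through the common endpoint, or from `y₀` for the path that
stops. -/
theorem isPathSystem (hm : 2 * m = b + c) (hy : 2 * y₀ = a + c)
    (hd : IsPathData a c m y₀ gL gR) :
    IsPathSystem a b c m y₀ (pathEdges a c m gL gR) (pathSteps a c m gL gR) := by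
  obtain ⟨k, hk, hky, g1, g2⟩ := hd.exists_glue
  have hL := hd.left
  have hR := hd.right
  have eL : ∀ h ≤ a, ∀ i ≤ m, (c : ℤ) ≤ i + leftPos a c gL h i ∧ leftPos a c gL h i ≤ a + c := by
    intro h hh i hi
    have := hL.le_self h i
    simp only [leftPos]
    omega
  have eR : ∀ h < a, ∀ t ≤ m + 1, 0 ≤ rightPos gR h t ∧ rightPos gR h t - t ≤ a - 1 := by
    intro h hh i hi
    have := hR.le_self h i
    simp only [rightPos]
    omega
  constructor
  · rintro x y (⟨h, i, hh, hi, rfl, rfl⟩ | ⟨h, t, hh, ht, hx, rfl⟩)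
    · have h1 := eL h hh i hi
      have h2 := hL.leftPos_le a c h hi
      have h3 : 0 ≤ leftPos a c gL h m ∧ leftPos a c gL h m + m ≤ a + b + c := by
        by_cases hhk : h = k
        · subst hhk
          omega
        · obtain ⟨h', hh', he⟩ := g2 h hh hhk
          have := eR h' hh' (m + 1) le_rfl
          push_cast at this
          omega
      unfold IsVerticalEdge
      omega
    · have h1 := eR h hh t (by omega)
      have h2 := hR.rightPos_le h (i := t) (j := m + 1) (by omega)
      obtain ⟨h', hh', -, he⟩ := g1 h hh
      have := eL h' hh' m le_rfl
      unfold IsVerticalEdge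
      push_cast at *
      omega
  · intro y hy
    obtain ⟨-, hy1, hy2, -⟩ := hy
    refine Or.inl ⟨(c + a - y).toNat, 0, by omega, by omega, rfl, ?_⟩
    simp only [leftPos, hL.zero]
    omega
  · intro y hy
    obtain ⟨-, hy1, -, hy2⟩ := hy
    refine Or.inr ⟨y.toNat, 0, by omega, by omega, by omega, ?_⟩
    simp only [rightPos, hR.zero]
    omega
  · exact Or.inl ⟨k, m, hk, le_rfl, rfl, hky.symm⟩
  · rintro x y y' (⟨h, i, hh, hi, hx, hy, hy'⟩ | ⟨h, t, hh, ht, hx, hy, hy'⟩)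
    · exact Or.inl ⟨h, i, hh, hi.le, hx, hy⟩
    -- At `t = m` the step starts on the cut, where `pathEdges` records only left positions.
    · rcases ht.eq_or_lt with rfl | ht
      · obtain ⟨h', hh', -, he⟩ := g1 h hh
        exact Or.inl ⟨h', t, hh', le_rfl, by omega, by rw [hy, he]⟩
      · exact Or.inr ⟨h, t + 1, hh, ht, by push_cast; omega, hy⟩
  · rintro x y y' (⟨h, i, hh, hi, hx, hy, hy'⟩ | ⟨h, t, hh, ht, hx, hy, hy'⟩)
    · exact Or.inl ⟨h, i + 1, hh, hi, by rw [hx]; push_cast; rfl, hy'⟩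
    · exact Or.inr ⟨h, t, hh, ht, by omega, hy'⟩
  · rintro x y y' (⟨h, i, hh, hi, hx, hy, hy'⟩ | ⟨h, t, hh, ht, hx, hy, hy'⟩) ⟨h1, h2⟩
    · omega
    · obtain rfl : t = m := by omega
      obtain ⟨h', hh', hne, he⟩ := g1 h hh
      rw [he, h2, ← hky, hL.leftPos_inj] at hy
      exact hne hy.symm
  · rintro x y y' (⟨h, i, hh, hi, hx, rfl, rfl⟩ | ⟨h, t, hh, ht, hx, rfl, rfl⟩)
    · have h1 := hL.le_succ h i
      have h2 := hL.succ_le h i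
      simp only [leftPos]
      push_cast
      omega
    · have h1 := hR.le_succ h t
      have h2 := hR.succ_le h t
      simp only [rightPos]
      push_cast
      omega
  · rintro x y (⟨h, i, hh, hi, hx, hy⟩ | ⟨h, t, hh, ht, hx, hy⟩) hxN hne
    · rcases hi.eq_or_lt with rfl | hi
      · obtain ⟨h', hh', he⟩ := g2 h hh (by
          rintro rfl
          exact hne ⟨hx, hy.trans hky⟩)
        exact ⟨_, Or.inr ⟨h', i, hh', le_rfl, by omega, by rw [hy, he], rfl⟩⟩
      · exact ⟨_, Or.inl ⟨h, i, hh, hi, hx, hy, rfl⟩⟩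
    · obtain ⟨t, rfl⟩ : ∃ t', t = t' + 1 := ⟨t - 1, by omega⟩
      push_cast at hx
      exact ⟨_, Or.inr ⟨h, t, hh, by omega, by omega, hy, rfl⟩⟩
  · rintro x y (⟨h, i, hh, hi, hx, hy⟩ | ⟨h, t, hh, ht, hx, hy⟩) hx0
    · obtain ⟨i, rfl⟩ : ∃ i', i = i' + 1 := ⟨i - 1, by omega⟩
      push_cast at hx
      exact ⟨_, Or.inl ⟨h, i, hh, hi, by omega, rfl, hy⟩⟩
    · exact ⟨_, Or.inr ⟨h, t, hh, ht, by omega, rfl, hy⟩⟩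
  · rintro x y y₁ y₂ (⟨h, i, hh, hi, hx, hy, rfl⟩ | ⟨h, t, hh, ht, hx, hy, rfl⟩)
      (⟨h', i', hh', hi', hx', hy', rfl⟩ | ⟨h', t', hh', ht', hx', hy', rfl⟩)
    · obtain rfl : i = i' := by omega
      rw [hL.leftPos_inj.1 (hy.symm.trans hy')]
    · omega
    · omega
    · obtain rfl : t = t' := by omega
      rw [hR.rightPos_inj.1 (hy.symm.trans hy')]
  · rintro x y₁ y₂ y (⟨h, i, hh, hi, hx, rfl, hy⟩ | ⟨h, t, hh, ht, hx, rfl, hy⟩)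
      (⟨h', i', hh', hi', hx', rfl, hy'⟩ | ⟨h', t', hh', ht', hx', rfl, hy'⟩)
    · obtain rfl : i = i' := by omega
      rw [hL.leftPos_inj.1 (hy.symm.trans hy')]
    · omega
    · omega
    · obtain rfl : t = t' := by omega
      rw [hR.rightPos_inj.1 (hy.symm.trans hy')]

/-- The steps of the paths determine the arrays. -/
theorem eq_of_pathSteps {gL' gR' : ℕ → ℕ → ℕ} (hm : 2 * m = b + c) (hy : 2 * y₀ = a + c)
    (hd : IsPathData a c m y₀ gL gR) (hd' : IsPathData a c m y₀ gL' gR')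
    (hS : ∀ x y y', pathSteps a c m gL gR x y y' → pathSteps a c m gL' gR' x y y') :
    gL = gL' ∧ gR = gR' := by
  have hs := hd'.isPathSystem hm hy
  have h1 : ∀ i ≤ m, ∀ h ≤ a, gL h i = gL' h i := by
    intro i
    induction i with
    | zero => intro _ h _; rw [hd.left.zero, hd'.left.zero]
    | succ i ih =>
      intro hi h hh
      have e := ih (by omega) h hh
      have e1 := hS _ _ _ (Or.inl ⟨h, i, hh, hi, rfl, rfl, rfl⟩)
      have e2 : pathSteps a c m gL' gR' _ _ _ := Or.inl ⟨h, i, hh, hi, rfl, rfl, rfl⟩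
      rw [show leftPos a c gL h i = leftPos a c gL' h i by simp [leftPos, e]] at e1
      have := hs.next_unique e1 e2
      simp only [leftPos] at this
      omega
  -- The right paths are traced from the right side, so predecessors have to be unique here.
  have h2 : ∀ t ≤ m + 1, ∀ h < a, gR h t = gR' h t := by
    intro t
    induction t with
    | zero => intro _ h _; rw [hd.right.zero, hd'.right.zero]
    | succ t ih =>
      intro ht h hh
      have e := ih (by omega) h hh
      have e1 := hS (2 * m - t) _ _ (Or.inr ⟨h, t, hh, by omega, by omega, rfl, rfl⟩)
      have e2 : pathSteps a c m gL' gR' (2 * m - t) _ _ :=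
        Or.inr ⟨h, t, hh, by omega, by omega, rfl, rfl⟩
      rw [show rightPos gR h t = rightPos gR' h t by simp [rightPos, e]] at e1
      have := hs.prev_unique e1 e2
      simp only [rightPos] at this
      omega
  constructor
  · funext h x
    by_cases hh : h ≤ a
    · rcases le_total x m with hx | hx
      · exact h1 x hx h hh
      · rw [hd.left.eq_of_le _ _ hx, hd'.left.eq_of_le _ _ hx, h1 m le_rfl h hh]
    · rw [hd.left.eq_zero (hd.left_zero h (by omega)),
        hd'.left.eq_zero (hd'.left_zero h (by omega))]
  · funext h x
    by_cases hh : h < a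
    · rcases le_total x (m + 1) with hx | hx
      · exact h2 x hx h hh
      · rw [hd.right.eq_of_le _ _ hx, hd'.right.eq_of_le _ _ hx, h2 (m + 1) le_rfl h hh]
    · rw [hd.right.eq_zero (hd.right_zero h (by omega)),
        hd'.right.eq_zero (hd'.right_zero h (by omega))]

end IsPathData

/-! ### Cutting a path system at the central abscissa -/

theorem IsPathSystem.exists_isPathData {a b c m y₀ : ℕ} {P : ℤ → ℤ → Prop}
    {S : ℤ → ℤ → ℤ → Prop} (hm : 2 * m = b + c) (hS : IsPathSystem a b c m y₀ P S) :
    ∃ gL gR, IsPathData a c m y₀ gL gR ∧ (∀ x y, P x y → pathEdges a c m gL gR x y) ∧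
      ∀ x y y', pathSteps a c m gL gR x y y' → S x y y' := by
  -- The shear `z = y + t` turns the steps `-1`, `0` into `0`, `1`.
  obtain ⟨gL, hL, zL, eL, sL⟩ := exists_isColumnArray (r := a + 1) (L := m) (s := c + a)
    (Q := fun t z => P t (z - t)) (B := fun t z z' => S t (z - t) (z' - t - 1))
    (fun z => by
      constructor
      · intro hz
        have := hS.isVerticalEdge hz
        unfold IsVerticalEdge at this
        exact ⟨(c + a - z).toNat, by omega, by omega⟩
      · rintro ⟨h, hh, rfl⟩
        refine hS.first ?_
        unfold IsVerticalEdge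
        omega)
    (fun {t z z'} _ h => by
      have := hS.right_mem h
      push_cast
      rwa [← sub_sub])
    (fun {t z z'} h => by
      have := hS.step h
      omega)
    (fun {t z} ht h => by
      obtain ⟨y, hy⟩ := hS.exists_next h (by omega) (by omega)
      exact ⟨y + t + 1, by simpa [add_sub_right_comm] using hy⟩)
    (fun {t z'} ht h => by
      push_cast at h
      obtain ⟨y, hy⟩ := hS.exists_prev h (by omega)
      refine ⟨y + t, ?_, ?_⟩
      · simpa using hS.left_mem hy
      · rw [sub_sub]
        simpa using hy)
    (fun {t z z₁ z₂} h h' => by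
      have := hS.next_unique h h'
      omega)
    (fun {t z₁ z₂ z'} h h' => by
      have := hS.prev_unique h h'
      omega)
  -- Time runs leftwards from the right side and `z = t - y`, so next and previous steps swap roles.
  -- The central edge is excluded since no step leaves it.
  obtain ⟨gR, hR, zR, eR, sR⟩ := exists_isColumnArray (r := a) (L := m + 1) (s := 0)
    (Q := fun t z => P (2 * m + 1 - t) (t - z) ∧ ¬ ((2 * m + 1 - t : ℤ) = m ∧ t - z = y₀))
    (B := fun t z z' => S (2 * m - t) (t + 1 - z') (t - z))
    (fun z => by
      constructor
      · rintro ⟨hz, -⟩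
        have := hS.isVerticalEdge hz
        unfold IsVerticalEdge at this
        exact ⟨(-z).toNat, by omega, by omega⟩
      · rintro ⟨h, hh, rfl⟩
        refine ⟨?_, by omega⟩
        have e : (2 * m + 1 - (0 : ℕ) : ℤ) = b + c + 1 := by omega
        rw [e]
        refine hS.last ?_
        unfold IsVerticalEdge
        omega)
    (fun {t z z'} _ h => by
      have h1 := hS.left_mem h
      have h2 := hS.ne_center h
      push_cast
      rw [add_sub_add_right_eq_sub]
      exact ⟨h1, h2⟩)
    (fun {t z z'} h => by
      have := hS.step h
      omega)
    (fun {t z} ht h => by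
      rw [add_sub_right_comm] at h
      obtain ⟨y, hy⟩ := hS.exists_prev h.1 (by omega)
      exact ⟨t + 1 - y, by simpa using hy⟩)
    (fun {t z'} ht h => by
      push_cast at h
      rw [add_sub_add_right_eq_sub] at h
      obtain ⟨y, hy⟩ := hS.exists_next h.1 (by omega) h.2
      refine ⟨t - y, ⟨?_, by omega⟩, ?_⟩
      · rw [add_sub_right_comm]
        simpa using hS.right_mem hy
      · simpa using hy)
    (fun {t z z₁ z₂} h h' => by
      have := hS.prev_unique h h'
      omega)
    (fun {t z₁ z₂ z'} h h' => by
      have := hS.next_unique h h'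
      omega)
  have posL : ∀ h i : ℕ, (c + a : ℤ) - h + gL h i - i = leftPos a c gL h i := by
    intro h i
    simp only [leftPos]
    ring
  have posR : ∀ h t : ℕ, (t : ℤ) - (0 - h + gR h t) = rightPos gR h t := by
    intro h i
    simp only [rightPos]
    ring
  have memL : ∀ i : ℕ, i ≤ m → ∀ y, P i y ↔ ∃ h ≤ a, y = leftPos a c gL h i := by
    intro i hi y
    have := eL i hi (y + i)
    rw [add_sub_cancel_right] at this
    rw [this]
    refine exists_congr fun h => and_congr Nat.lt_succ_iff ?_
    rw [← posL]
    omega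
  have memR : ∀ t : ℕ, t ≤ m + 1 → ∀ y,
      P (2 * m + 1 - t) y ∧ ¬ ((2 * m + 1 - t : ℤ) = m ∧ y = y₀) ↔
        ∃ h < a, y = rightPos gR h t := by
    intro t ht y
    have := eR t ht (t - y)
    rw [sub_sub_cancel] at this
    rw [this]
    refine exists_congr fun h => and_congr Iff.rfl ?_
    rw [← posR]
    omega
  refine ⟨gL, gR, ⟨hL, hR, fun h hh => zL h hh, zR, ?_⟩, ?_, ?_⟩
  · obtain ⟨k, hk, hky⟩ := (memL m le_rfl y₀).1 hS.center
    have hmem : ∀ y, (∃ h < a, y = rightPos gR h (m + 1)) ↔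
        (∃ h ≤ a, y = leftPos a c gL h m) ∧ y ≠ y₀ := by
      intro y
      rw [← memR (m + 1) le_rfl, ← memL m le_rfl,
        show (2 * m + 1 - (m + 1 : ℕ) : ℤ) = m by push_cast; ring]
      simp
    refine ⟨k, hk, hky.symm, ?_⟩
    -- Both sides increase strictly in `h` and list the same endpoints, hence agree. The index `a -
    -- 1 - h` appears because left paths are counted from above, right ones from below.
    have hinj : (fun h : Fin a => rightPos gR h (m + 1)) =
        fun h : Fin a => leftPos a c gL (skip k (a - 1 - h)) m := by
      rw [← StrictMono.range_inj]
      · ext y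
        have := hmem y
        simp only [Set.mem_range]
        constructor
        · rintro ⟨h, rfl⟩
          obtain ⟨⟨h', hh', he⟩, hne⟩ := this.1 ⟨h, h.2, rfl⟩
          rw [he] at hne ⊢
          have hk' : h' ≠ k := by
            rintro rfl
            exact hne hky.symm
          rcases lt_or_gt_of_ne hk' with hlt | hlt
          · refine ⟨⟨a - 1 - h', by omega⟩, ?_⟩
            congr 1
            simp only [skip]
            split_ifs <;> omega
          · refine ⟨⟨a - h', by omega⟩, ?_⟩
            congr 1
            simp only [skip]
            split_ifs <;> omega
        · rintro ⟨⟨h, hh⟩, rfl⟩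
          obtain ⟨h', hh', he⟩ := this.2 ⟨⟨skip k (a - 1 - h), by
            unfold skip; split_ifs <;> omega, rfl⟩, by
              intro he
              rw [hky, hL.leftPos_inj] at he
              simp only [skip] at he
              split_ifs at he <;> omega⟩
          exact ⟨⟨h', hh'⟩, he.symm⟩
      · exact fun h h' hh => hR.rightPos_lt _ hh
      · intro h h' hh
        refine hL.leftPos_lt a c m ?_
        rw [Fin.lt_def] at hh
        have := h'.2
        simp only [skip]
        split_ifs <;> omega
    intro h hh
    have := congrFun hinj ⟨h, hh⟩
    simp only [rightPos, leftPos] at this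
    push_cast at this
    exact this
  · intro x y hP
    have he := (hS.isVerticalEdge hP).1
    rcases le_or_gt x m with hx | hx
    · lift x to ℕ using he.1
      obtain ⟨h, hh, hy⟩ := (memL x (by omega) y).1 hP
      exact Or.inl ⟨h, x, hh, by omega, rfl, hy⟩
    · obtain ⟨t, ht⟩ : ∃ t : ℕ, x = 2 * m + 1 - t := ⟨(2 * m + 1 - x).toNat, by omega⟩
      subst ht
      obtain ⟨h, hh, hy⟩ := (memR t (by omega) y).1 ⟨hP, by omega⟩
      exact Or.inr ⟨h, t, hh, by omega, by omega, hy⟩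
  · rintro x y y' (⟨h, i, hh, hi, rfl, rfl, rfl⟩ | ⟨h, t, hh, ht, hx, rfl, rfl⟩)
    · have := sL i hi h (by omega)
      rw [posL, sub_sub] at this
      rw [← posL h (i + 1)]
      push_cast
      exact this
    · have := sR t (by omega) h hh
      rw [posR] at this
      obtain rfl : x = 2 * m - t := by omega
      rw [← posR h (t + 1)]
      push_cast
      exact this

/-! ### Partition pairs as endpoint data -/

theorem conjugatePart_add_one (lam : YoungDiagram) (h : ℕ) :
    conjugatePart lam (h + 1) = lam.colLen h := by
  simp [conjugatePart]

/-- Under `i_h = y₀ - leftPos` for the path with index `h - 1`, both conditions say the same. The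
bounds on the `i_h` then come for free from nonnegativity of column lengths. -/
theorem mem_partitionPairs_iff {a b c m y₀ : ℕ} (hm : 2 * m = b + c) (hy : 2 * y₀ = a + c)
    (p : YoungDiagram × YoungDiagram) : p ∈ partitionPairs a b ↔
      IsGluing a c m y₀ p.1.colLen p.2.colLen ∧ (∀ h, a ≤ h → p.1.colLen h = 0) ∧
        ∀ h, a < h → p.2.colLen h = 0 := by
  have e1 : ((b : ℤ) - a) / 2 = m - y₀ := by omega
  have e2 : ((a : ℤ) + b) / 2 = m + y₀ - c := by omega
  constructor
  · rintro ⟨k, hk, i, -, -, hik, -, h1, h2, h3, h4⟩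
    rw [e1] at h1 h3
    have h3' : ∀ h ≤ a, (p.2.colLen h : ℤ) = m - y₀ - i (h + 1) + h := by
      intro h hh
      have := h3 (h + 1) (by omega) (by omega)
      rw [conjugatePart_add_one] at this
      push_cast at this
      omega
    refine ⟨⟨k, hk, ?_, fun h hh => ?_⟩, fun h hh => ?_, fun h hh => ?_⟩
    · rw [h3' k hk, hik]
      omega
    · have hs : skip k (a - 1 - h) ≤ a := by
        unfold skip
        split_ifs <;> omega
      have e := h1 (h + 1) (by omega) (by omega)
      rw [conjugatePart_add_one] at e
      rw [h3' _ hs, e]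
      have : a + 1 - (h + 1) + (if k + 1 ≤ a + 1 - (h + 1) then 1 else 0) =
          skip k (a - 1 - h) + 1 := by
        unfold skip
        split_ifs <;> omega
      rw [this]
      push_cast
      omega
    · rw [← conjugatePart_add_one]
      exact h2 _ (by omega)
    · rw [← conjugatePart_add_one]
      exact h4 _ (by omega)
  · rintro ⟨⟨k, hk, g1, g2⟩, z1, z2⟩
    have hanti : ∀ h h', h ≤ h' → p.2.colLen h' ≤ p.2.colLen h := fun h h' hh =>
      p.2.colLen_anti h h' hh
    refine ⟨k, hk, fun h => m - y₀ + (h - 1 : ℕ) - p.2.colLen (h - 1), ?_, ?_, ?_, ?_, ?_, ?_, ?_,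
      ?_⟩
    · simp only
      rw [e2]
      -- If `k = 0` then `i 1 = 0`; otherwise the lower bound says that the `a`-th column of the
      -- first diagram has nonnegative length.
      rcases Nat.eq_zero_or_pos k with rfl | hk0
      · simp only [Nat.sub_self]
        omega
      · have := g2 (a - 1) (by omega)
        rw [Nat.sub_self, show skip k 0 = 0 by simp [skip, hk0]] at this
        simp only [Nat.sub_self]
        omega
    · intro h hh h' hh' hlt
      rw [Set.mem_Icc] at hh hh'
      have := hanti (h - 1) (h' - 1) (by omega)
      simp only
      omega
    · simp only [Nat.add_sub_cancel]
      omega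
    · simp only [Nat.add_sub_cancel]
      rw [e2]
      omega
    · intro h hh hha
      obtain ⟨h, rfl⟩ : ∃ h', h = h' + 1 := ⟨h - 1, by omega⟩
      have := g2 h (by omega)
      have e : a + 1 - (h + 1) + (if k + 1 ≤ a + 1 - (h + 1) then 1 else 0) =
          skip k (a - 1 - h) + 1 := by
        unfold skip
        split_ifs <;> omega
      rw [conjugatePart_add_one, e, e1]
      simp only [Nat.add_sub_cancel]
      push_cast
      omega
    · intro h hh
      obtain ⟨h, rfl⟩ : ∃ h', h = h' + 1 := ⟨h - 1, by omega⟩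
      rw [conjugatePart_add_one]
      exact z1 h (by omega)
    · intro h hh hha
      obtain ⟨h, rfl⟩ : ∃ h', h = h' + 1 := ⟨h - 1, by omega⟩
      rw [conjugatePart_add_one, e1]
      simp only [Nat.add_sub_cancel]
      push_cast
      omega
    · intro h hh
      obtain ⟨h, rfl⟩ : ∃ h', h = h' + 1 := ⟨h - 1, by omega⟩
      rw [conjugatePart_add_one]
      exact z2 h (by omega)

/-! ### Young diagrams from column lengths; finiteness -/

/-- Young diagrams are determined by the lengths of their columns. -/
theorem YoungDiagram.ext_colLen {lam mu : YoungDiagram} (h : ∀ j, lam.colLen j = mu.colLen j) :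
    lam = mu := by
  apply YoungDiagram.ext
  ext ⟨i, j⟩
  rw [YoungDiagram.mem_cells, YoungDiagram.mem_cells, YoungDiagram.mem_iff_lt_colLen,
    YoungDiagram.mem_iff_lt_colLen, h]

theorem YoungDiagram.exists_colLen {u : ℕ → ℕ} (hu : Antitone u) {r : ℕ}
    (hr : ∀ j, r ≤ j → u j = 0) : ∃ lam : YoungDiagram, ∀ j, lam.colLen j = u j := by
  obtain ⟨s, hs⟩ : ∃ s : Finset (ℕ × ℕ), ∀ i j, (i, j) ∈ s ↔ i < u j := by
    refine ⟨(Finset.range (u 0) ×ˢ Finset.range r).filter fun x => x.1 < u x.2, fun i j => ?_⟩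
    simp only [Finset.mem_filter, Finset.mem_product, Finset.mem_range, and_iff_right_iff_imp]
    intro hij
    refine ⟨hij.trans_le (hu (Nat.zero_le j)), ?_⟩
    by_contra hj
    rw [hr j (by omega)] at hij
    omega
  have hlower : IsLowerSet (s : Set (ℕ × ℕ)) := by
    rintro ⟨i, j⟩ ⟨i', j'⟩ ⟨hi, hj⟩ hx
    rw [Finset.mem_coe, hs] at hx ⊢
    exact (hi.trans_lt hx).trans_le (hu hj)
  refine ⟨⟨s, hlower⟩, fun j => ?_⟩
  have key : ∀ i, i < YoungDiagram.colLen ⟨s, hlower⟩ j ↔ i < u j := fun i => by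
    rw [← YoungDiagram.mem_iff_lt_colLen, ← YoungDiagram.mem_cells, hs]
  exact le_antisymm (le_of_forall_lt fun i hi => (key i).1 hi)
    (le_of_forall_lt fun i hi => (key i).2 hi)

theorem YoungDiagram.finite_setOf_colLen_le (B r : ℕ) :
    {lam : YoungDiagram | lam.colLen 0 ≤ B ∧ ∀ j, r ≤ j → lam.colLen j = 0}.Finite := by
  refine Set.Finite.of_finite_image (f := YoungDiagram.cells)
    ((Finset.finite_toSet (Finset.range B ×ˢ Finset.range r).powerset).subset ?_)
    (fun _ _ _ _ h => YoungDiagram.ext h)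
  rintro _ ⟨lam, ⟨h0, hr⟩, rfl⟩
  rw [Finset.mem_coe, Finset.mem_powerset]
  rintro ⟨i, j⟩ hij
  rw [YoungDiagram.mem_cells, YoungDiagram.mem_iff_lt_colLen] at hij
  have h1 := lam.colLen_anti 0 j (Nat.zero_le j)
  rw [Finset.mem_product, Finset.mem_range, Finset.mem_range]
  refine ⟨by simp only; omega, ?_⟩
  by_contra hj
  rw [hr j (by simpa using hj)] at hij
  omega

theorem partitionPairs_finite {a b c m y₀ : ℕ} (ha : 0 < a) (hm : 2 * m = b + c)
    (hy : 2 * y₀ = a + c) : (partitionPairs a b).Finite := by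
  refine ((YoungDiagram.finite_setOf_colLen_le (2 * m + 1) a).prod
    (YoungDiagram.finite_setOf_colLen_le (y₀ + 2 * m) (a + 1))).subset ?_
  rintro ⟨lam, mu⟩ hp
  obtain ⟨⟨k, hk, g1, g2⟩, z1, z2⟩ := (mem_partitionPairs_iff hm hy _).1 hp
  simp only at g1 g2 z1 z2
  have h1 : lam.colLen 0 ≤ 2 * m + 1 := by
    have := g2 0 ha
    have hs : skip k (a - 1 - 0) ≤ a := by
      unfold skip
      split_ifs <;> omega
    omega
  refine ⟨⟨h1, z1⟩, ⟨?_, fun j hj => z2 j hj⟩⟩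
  simp only
  rcases Nat.eq_zero_or_pos k with rfl | hk0
  · omega
  · have := g2 (a - 1) (by omega)
    rw [Nat.sub_self, show skip k 0 = 0 by simp [skip, hk0]] at this
    omega

/-! ### The bijection and the count -/

theorem isPathData_columnArray {a b c m y₀ : ℕ} (hm : 2 * m = b + c) (hy : 2 * y₀ = a + c)
    {p : YoungDiagram × YoungDiagram} (hp : p ∈ partitionPairs a b)
    (T₁ : BoundedTableau (m + 1) p.1) (T₂ : BoundedTableau m p.2) :
    IsPathData a c m y₀ T₂.1.columnArray T₁.1.columnArray := by
  obtain ⟨h1, h2, h3⟩ := (mem_partitionPairs_iff hm hy p).1 hp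
  refine ⟨T₂.isColumnArray, T₁.isColumnArray, fun h hh => ?_, fun h hh => ?_, ?_⟩
  · rw [T₂.columnArray_eq_colLen, h3 h hh]
  · rw [T₁.columnArray_eq_colLen, h2 h hh]
  · simpa only [T₁.columnArray_eq_colLen, T₂.columnArray_eq_colLen] using h1

theorem IsPathData.exists_tableaux {a b c m y₀ : ℕ} (hm : 2 * m = b + c) (hy : 2 * y₀ = a + c)
    {gL gR : ℕ → ℕ → ℕ} (hd : IsPathData a c m y₀ gL gR) :
    ∃ p ∈ partitionPairs a b, ∃ (T₁ : BoundedTableau (m + 1) p.1) (T₂ : BoundedTableau m p.2),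
      T₂.1.columnArray = gL ∧ T₁.1.columnArray = gR := by
  obtain ⟨lam, hlam⟩ := YoungDiagram.exists_colLen (hd.right.antitone (m + 1)) hd.right_zero
  obtain ⟨mu, hmu⟩ := YoungDiagram.exists_colLen (hd.left.antitone m) (r := a + 1) hd.left_zero
  obtain ⟨T₁, h1⟩ := hd.right.exists_tableau fun h => (hlam h).symm
  obtain ⟨T₂, h2⟩ := hd.left.exists_tableau fun h => (hmu h).symm
  refine ⟨(lam, mu), (mem_partitionPairs_iff hm hy _).2 ⟨?_, ?_, ?_⟩, T₁, T₂, h2, h1⟩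
  · rw [funext hlam, funext hmu]
    exact hd.glue
  · intro h hh
    rw [hlam, hd.right_zero h hh]
  · intro h hh
    rw [hmu, hd.left_zero h hh]

/-- The tiling that belongs to a pair of column arrays. -/
def pathTiling (a b c m : ℕ) (gL gR : ℕ → ℕ → ℕ) : Set (Set UnitTriangle) :=
  {r | ∃ u d, pathMatching a b c (pathEdges a c m gL gR) (pathSteps a c m gL gR) u d ∧
    r = UnitTriangle.pair u d}

theorem pathSteps_iff_mem_pathTiling {a b c m : ℕ} {gL gR : ℕ → ℕ → ℕ} {x y y' : ℤ} :
    pathSteps a c m gL gR x y y' ↔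
      UnitTriangle.pair (x, y) (x, y') ∈ pathTiling a b c m gL gR := by
  constructor
  · intro h
    exact ⟨(x, y), (x, y'), Or.inl ⟨rfl, h⟩, rfl⟩
  · rintro ⟨u, d, h, he⟩
    obtain ⟨rfl, rfl⟩ := UnitTriangle.pair_inj.1 he
    rcases h with ⟨-, h⟩ | ⟨h, -⟩
    · exact h
    · simp at h

/-- Pairs of tableaux whose shapes form one of the pairs of partitions are in bijection with the
tilings of the punctured hexagon. -/
theorem exists_bijective_rhombusTilings {a b c m y₀ : ℕ} (hm : 2 * m = b + c)
    (hy : 2 * y₀ = a + c) :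
    ∃ F : (Σ p : partitionPairs a b, BoundedTableau (m + 1) p.1.1 × BoundedTableau m p.1.2) →
      rhombusTilings (puncturedHexagon a b c), Function.Bijective F := by
  refine ⟨fun q => ⟨pathTiling a b c m q.2.2.1.columnArray q.2.1.1.columnArray,
    (((isPathData_columnArray hm hy q.1.2 q.2.1 q.2.2).isPathSystem hm hy).isMatching
      hm hy).mem_rhombusTilings⟩, ?_, ?_⟩
  · rintro ⟨⟨⟨lam, mu⟩, hp⟩, T₁, T₂⟩ ⟨⟨⟨lam', mu'⟩, hp'⟩, T₁', T₂'⟩ he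
    have he := Subtype.ext_iff.1 he
    simp only at T₁ T₂ T₁' T₂' he
    obtain ⟨e1, e2⟩ := (isPathData_columnArray hm hy hp T₁ T₂).eq_of_pathSteps hm hy
      (isPathData_columnArray hm hy hp' T₁' T₂') fun x y y' h => by
        rw [pathSteps_iff_mem_pathTiling (b := b)] at h ⊢
        rwa [← he]
    obtain rfl : lam = lam' := YoungDiagram.ext_colLen fun j => by
      rw [← T₁.columnArray_eq_colLen, ← T₁'.columnArray_eq_colLen, e2]
    obtain rfl : mu = mu' := YoungDiagram.ext_colLen fun j => by
      rw [← T₂.columnArray_eq_colLen, ← T₂'.columnArray_eq_colLen, e1]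
    obtain rfl := BoundedTableau.columnArray_injective _ _ e1
    obtain rfl := BoundedTableau.columnArray_injective _ _ e2
    rfl
  · rintro ⟨T, hT⟩
    have hM := isMatching_of_mem_rhombusTilings hT
    obtain ⟨gL, gR, hd, hP, hS⟩ := (hM.isPathSystem hm hy).exists_isPathData hm
    obtain ⟨p, hp, T₁, T₂, rfl, rfl⟩ := hd.exists_tableaux hm hy
    refine ⟨⟨⟨p, hp⟩, T₁, T₂⟩, Subtype.ext (eq_of_mem_rhombusTilings_of_subset
      ((hd.isPathSystem hm hy).isMatching hm hy).mem_rhombusTilings hT ?_)⟩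
    -- The two inclusions suffice: `hS` handles rhombi crossed by a path, and `hP` in contrapositive
    -- form the remaining ones.
    rintro r ⟨⟨x, y⟩, ⟨z, w⟩, h, rfl⟩
    rcases h with ⟨h1, h2⟩ | ⟨h1, h2, h3, h4⟩
    · simp only at h1 h2
      subst h1
      exact hS _ _ _ h2
    · simp only at h1 h2 h3 h4
      subst h1 h2
      by_contra hc
      exact h4 (hP _ _ ⟨h3, by rwa [add_sub_cancel_right]⟩)

/-- The finiteness clauses ensure that neither `ncard` nor `∑ᶠ` takes its default value `0` for
infinite sets. -/
theorem proposition2 (a b c : ℕ) (ha : 0 < a) (hb : 0 < b) (hc : 0 < c)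
    (hab : a ≡ b [MOD 2]) (hbc : b ≡ c [MOD 2]) :
    (rhombusTilings (puncturedHexagon a b c)).Finite ∧ (partitionPairs a b).Finite ∧
    ((rhombusTilings (puncturedHexagon a b c)).ncard : ℤ) =
      ∑ᶠ p ∈ partitionPairs a b,
        MvPolynomial.eval (fun _ => (1 : ℤ))
          (schurFunction ((b + c + 2) / 2) p.1 * schurFunction ((b + c) / 2) p.2) := by
  unfold Nat.ModEq at hab hbc
  obtain ⟨m, hm⟩ : ∃ m, 2 * m = b + c := ⟨(b + c) / 2, by omega⟩
  obtain ⟨y₀, hy⟩ : ∃ y₀, 2 * y₀ = a + c := ⟨(a + c) / 2, by omega⟩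
  have hpairs := partitionPairs_finite ha hm hy
  have : Finite (partitionPairs a b) := hpairs
  have : Fintype (partitionPairs a b) := Fintype.ofFinite _
  obtain ⟨F, hF⟩ := exists_bijective_rhombusTilings (a := a) hm hy
  refine ⟨Set.finite_coe_iff.1 (Finite.of_surjective F hF.2), hpairs, ?_⟩
  rw [show (b + c + 2) / 2 = m + 1 by omega, show (b + c) / 2 = m by omega,
    ← Nat.card_coe_set_eq, ← Nat.card_eq_of_bijective F hF, Nat.card_sigma,
    ← finsum_set_coe_eq_finsum_mem, finsum_eq_sum_of_fintype]
  push_cast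
  refine Finset.sum_congr rfl fun p _ => ?_
  rw [Nat.card_prod, map_mul, eval_one_schurFunction, eval_one_schurFunction, Nat.cast_mul]
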